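/- Theorem. For a DAG $G=(V,E)$ let $\mathsf{parents}(v)=\{u:(u,v)\in E\}$; a source is a node without parents, a sink is a node without outgoing edges, and $\mathsf{indeg}(G)=\max_v|\mathsf{parents}(v)|$. A legal parallel pebbling of $G$ is a sequence $P=(P_0,\dots,P_t)$ of subsets of $V$ with $P_0=\emptyset$ such that every sink lies in some $P_z$, $z\le t$, and such that for all $1\le i\le t$ and all $x\in P_i\setminus P_{i-1}$ we have $\mathsf{parents}(x)\subseteq P_{i-1}$ (any number of pebbles may be placed or removed in one step). There is a family of DAGs $\{G_n=([n],E_n)\}_{n\ge 1}$ with $\mathsf{indeg}(G_n)\le 2$ for all $n$ and $\mathsf{indeg}(G_n)=2$ for all $n\ge 3$, and there are constants $c_1,c_2,c_3>0$, such that for every $n\ge 2$ the set $S$ of sources of $G_n$ satisfies $|S|\le c_1 n/\log n$, and for every legal parallel pebbling $P=(P_0,\dots,P_t)$ of $G_n$ there is an interval $[i,j]$ with $1\le i\le j\le t$ such that (1) $\left|S\cap\left(\bigcup_{k=i}^{j}P_k\setminus P_{i-1}\right)\right|\ge c_2 n/\log n$, i.e. at least $c_2 n/\log n$ sources are (re)pebbled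 during the interval, and (2) $|P_k|\ge c_3 n/\log n$ for all $k\in[i,j]$, i.e. at least $c_3n/\log n$ pebbles are on the graph at every step of the interval. -/

import Mathlib

namespace Pebbling

open scoped Classical in
/-- The set of parents of `v`: the nodes `u` with an edge `(u, v)`. -/
noncomputable def parents {V : Type*} [Fintype V] (G : Digraph V) (v : V) : Finset V :=
  Finset.univ.filter fun u => G.Adj u v

/-- A digraph is acyclic (a DAG) if it has no directed closed walk of positive length;
in particular it has no loops. -/
def IsDAG {V : Type*} (G : Digraph V) : Prop :=
  ∀ v : V, ¬ Relation.TransGen G.Adj v v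

/-- The indegree of a digraph is the maximum indegree of its nodes. -/
noncomputable def indeg {V : Type*} [Fintype V] (G : Digraph V) : ℕ :=
  Finset.univ.sup fun v => (parents G v).card

open scoped Classical in
/-- The sources: the nodes without parents. -/
noncomputable def sources {V : Type*} [Fintype V] (G : Digraph V) : Finset V :=
  Finset.univ.filter fun v => parents G v = ∅

open scoped Classical in
/-- The sinks: the nodes without outgoing edges. -/
noncomputable def sinks {V : Type*} [Fintype V] (G : Digraph V) : Finset V :=
  Finset.univ.filter fun v => ∀ u, ¬ G.Adj v u

/-- `(P 0, …, P t)` is a legal parallel pebbling of the target set `T` in `G`.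
The values `P k` for `k > t` are irrelevant. -/
structure IsParallelPebblingOf {V : Type*} [Fintype V] (G : Digraph V) (T : Finset V)
    (t : ℕ) (P : ℕ → Finset V) : Prop where
  /-- The graph is initially empty. -/
  start : P 0 = ∅
  /-- Every target node is pebbled at some step, not necessarily simultaneously. -/
  complete : ∀ x ∈ T, ∃ z ≤ t, x ∈ P z
  /-- A pebble can be added only if all parents were pebbled at the end of the previous step. -/
  legal : ∀ i, 1 ≤ i → i ≤ t → ∀ x, x ∈ P i → x ∉ P (i - 1) → parents G x ⊆ P (i - 1)

/-- A legal parallel pebbling of `G`: the target set is the set of all sinks. -/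
def IsParallelPebbling {V : Type*} [Fintype V] (G : Digraph V)
    (t : ℕ) (P : ℕ → Finset V) : Prop :=
  IsParallelPebblingOf G (sinks G) t P

end Pebbling

/-!
The graphs are a variant of the recursive construction of Paul, Tarjan and Celoni. A network with
`2 * N` inputs and outputs consists of two copies of a network with `N` inputs and outputs,
stacked between a layer of inputs and a layer of outputs. The outputs of the first copy are
matched with the inputs of the second, the second copy feeds the output layer through a disperser,
and the input layer feeds both copies and the output layer through dispersers. Here a disperser is
a bipartite graph of bounded degree in which any two sets of constant density are joined by an
edge; a union bound shows that they exist (`exists_isDisperser`). After `i` doublings of a single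
vertex the network has `N = 2 ^ i` inputs and `(2 * i + 1) * N` vertices, so that `N` is of order
`n / log n` for the number `n` of vertices.

The invariant of the recursion (`IsNet.interval`) says: if the network carries few pebbles at
time `s` and a constant fraction of the outputs is freshly pebbled during `(s, b]`, then there is
a subinterval in which half of the inputs are freshly pebbled while at least `N / 64` vertices are
pebbled at every time. For the induction step (`IsNet.stack`) suppose that it fails for the large
network, and call a time sparse if fewer than twice the number of pebbles promised by the small
network are present. An interval without sparse times that starts from few pebbles cannot freshly
pebble a constant fraction of a layer fed by the inputs, because the disperser would then force
almost all inputs to be freshly pebbled. Hence, whenever many vertices of such a layer are freshly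
pebbled, most of them are pebbled after a sparse time in the interval (`IsTrace.exists_sparse`).
Applied to the output layer, this gives a sparse time from which the second copy is traversed, so
the invariant of the second copy gives an interval in which that copy is crowded and half of its
inputs are freshly pebbled. Applied to these inputs, it gives a sparse time within this interval
from which the outputs of the first copy are freshly pebbled, so the first copy is crowded during
a subinterval, while half of its inputs are freshly pebbled. Applied to those inputs, it gives
a sparse time at which both copies are crowded, a contradiction.

The in-degree is bounded but larger than two. Replacing each vertex by a path reduces it to two
(`chain`). The invariant survives because it is stated for traces (`IsTrace`), which only record
which paths carry a pebble at all and which carry one at their end. Finally, extra vertices with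
two fixed parents fill up the vertex set (`pad`), which makes the in-degree exactly two and creates
no sources. In a DAG every vertex reaches a sink, so every pebbling pebbles all vertices
(`IsDAG.exists_mem`) and the invariant applies to the whole pebbling.
-/

namespace Pebbling

/-! ### Dispersers -/

/-- A bipartite graph of degree `d`, given by listing the neighbours `f y j` of each `y`, is a
disperser if any two sets that each contain at least a fraction `1/32` of their side are joined
by an edge. -/
def IsDisperser {a b d : ℕ} (f : Fin a → Fin d → Fin b) : Prop :=
  ∀ (A : Set (Fin a)) (B : Set (Fin b)), a ≤ 32 * A.ncard → b ≤ 32 * B.ncard →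
    ∃ y ∈ A, ∃ j, f y j ∈ B

open Classical in
/-- The number of graphs of degree `32 * m` without an edge between two fixed dense sets. -/
theorem card_avoiding_le {a b m : ℕ} (A : Finset (Fin a)) (B : Finset (Fin b))
    (hA : a ≤ 32 * A.card) (hB : b ≤ 32 * B.card) :
    ((Finset.univ.filter fun f : Fin a → Fin (32 * m) → Fin b =>
      ∀ y ∈ A, ∀ j, f y j ∉ B).card : ℝ) ≤
      ((31 / 32 : ℝ) ^ m) ^ a * (((b : ℝ) ^ (32 * m)) ^ a) := by
  have hset : (Finset.univ.filter fun f : Fin a → Fin (32 * m) → Fin b =>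
      ∀ y ∈ A, ∀ j, f y j ∉ B) =
      Fintype.piFinset fun y : Fin a => Fintype.piFinset fun _ : Fin (32 * m) =>
        if y ∈ A then Bᶜ else Finset.univ := by
    ext f
    simp only [Finset.mem_filter, Finset.mem_univ, true_and, Fintype.mem_piFinset]
    refine forall_congr' fun y => ?_
    by_cases hy : y ∈ A <;> simp [hy]
  have hcompl : ((Bᶜ.card : ℕ) : ℝ) ≤ 31 / 32 * b := by
    have h1 := Finset.card_add_card_compl B
    rw [Fintype.card_fin] at h1
    have h2 : (B.card : ℝ) + (Bᶜ.card : ℝ) = b := by exact_mod_cast h1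
    have h3 : (b : ℝ) ≤ 32 * B.card := by exact_mod_cast hB
    linarith
  rw [hset, Fintype.card_piFinset]
  push_cast
  calc ∏ y : Fin a, ((Fintype.piFinset fun _ : Fin (32 * m) =>
          if y ∈ A then Bᶜ else (Finset.univ : Finset (Fin b))).card : ℝ)
      ≤ ∏ y : Fin a, ((if y ∈ A then (31 / 32 : ℝ) ^ (32 * m) else 1) * (b : ℝ) ^ (32 * m)) := by
        refine Finset.prod_le_prod (fun _ _ => by positivity) fun y _ => ?_
        by_cases hy : y ∈ A
        · simp only [hy, if_true, Fintype.card_piFinset, Finset.prod_const, Finset.card_univ,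
            Fintype.card_fin, Nat.cast_pow]
          rw [← mul_pow]
          exact pow_le_pow_left₀ (by positivity) hcompl _
        · simp [hy]
    _ = (31 / 32 : ℝ) ^ (m * (32 * A.card)) * ((b : ℝ) ^ (32 * m)) ^ a := by
        rw [Finset.prod_mul_distrib, Finset.prod_ite]
        simp only [Finset.prod_const, one_pow, mul_one, Finset.card_univ, Fintype.card_fin]
        rw [Finset.filter_mem_eq_inter, Finset.univ_inter, ← pow_mul]
        ring_nf
    _ ≤ _ := by
        rw [← pow_mul (31 / 32 : ℝ) m a]
        refine mul_le_mul_of_nonneg_right ?_ (by positivity)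
        exact pow_le_pow_of_le_one (by norm_num) (by norm_num) (Nat.mul_le_mul_left m hA)

open Classical in
/-- Dispersers of bounded degree exist. A union bound over the at most `8 ^ a` pairs of sets
works because the fraction of graphs that avoid a given pair is at most `((31/32) ^ 96) ^ a`. -/
theorem exists_isDisperser :
    ∃ d : ℕ, 0 < d ∧ ∀ a b : ℕ, 0 < a → 0 < b → b ≤ 2 * a →
      ∃ f : Fin a → Fin d → Fin b, IsDisperser f := by
  refine ⟨32 * 96, by norm_num, fun a b ha hb hab => ?_⟩
  by_contra! hno
  let avoid (p : Finset (Fin a) × Finset (Fin b)) : Finset (Fin a → Fin (32 * 96) → Fin b) :=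
    Finset.univ.filter fun f => ∀ y ∈ p.1, ∀ j, f y j ∉ p.2
  let dense : Finset (Finset (Fin a) × Finset (Fin b)) :=
    Finset.univ.filter fun p => a ≤ 32 * p.1.card ∧ b ≤ 32 * p.2.card
  have hcover : (Finset.univ : Finset (Fin a → Fin (32 * 96) → Fin b)) ⊆ dense.biUnion avoid := by
    intro f _
    have hf := hno f
    unfold IsDisperser at hf
    push Not at hf
    obtain ⟨A, B, hA, hB, h⟩ := hf
    refine Finset.mem_biUnion.2 ⟨(A.toFinset, B.toFinset), ?_, ?_⟩
    · simp only [dense, Finset.mem_filter, Finset.mem_univ, true_and]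
      rw [← Set.ncard_eq_toFinset_card', ← Set.ncard_eq_toFinset_card']
      exact ⟨hA, hB⟩
    · simp only [avoid, Finset.mem_filter, Finset.mem_univ, true_and, Set.mem_toFinset]
      exact h
  have hcount : (((b : ℝ) ^ (32 * 96)) ^ a) ≤
      8 ^ a * (((31 / 32 : ℝ) ^ 96) ^ a * (((b : ℝ) ^ (32 * 96)) ^ a)) := by
    have h1 : ((Finset.univ : Finset (Fin a → Fin (32 * 96) → Fin b)).card : ℝ) ≤
        ∑ p ∈ dense, ((avoid p).card : ℝ) := by
      exact_mod_cast (Finset.card_le_card hcover).trans Finset.card_biUnion_le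
    have h2 : ∑ p ∈ dense, ((avoid p).card : ℝ) ≤
        dense.card • (((31 / 32 : ℝ) ^ 96) ^ a * (((b : ℝ) ^ (32 * 96)) ^ a)) := by
      refine Finset.sum_le_card_nsmul _ _ _ fun p hp => ?_
      simp only [dense, Finset.mem_filter, Finset.mem_univ, true_and] at hp
      exact card_avoiding_le p.1 p.2 hp.1 hp.2
    have h3 : dense.card ≤ 8 ^ a := by
      calc dense.card ≤ Fintype.card (Finset (Fin a) × Finset (Fin b)) := Finset.card_le_univ _
        _ = 2 ^ (a + b) := by simp [Fintype.card_prod, pow_add]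
        _ ≤ 2 ^ (3 * a) := Nat.pow_le_pow_right (by norm_num) (by omega)
        _ = 8 ^ a := by rw [pow_mul]; norm_num
    have h4 : ((Finset.univ : Finset (Fin a → Fin (32 * 96) → Fin b)).card : ℝ) =
        ((b : ℝ) ^ (32 * 96)) ^ a := by
      rw [Finset.card_univ, Fintype.card_fun, Fintype.card_fun, Fintype.card_fin,
        Fintype.card_fin, Fintype.card_fin]
      push_cast
      rfl
    rw [← h4]
    refine h1.trans (h2.trans ?_)
    rw [h4, nsmul_eq_mul]
    gcongr
    exact_mod_cast h3
  have hpos : (0 : ℝ) < ((b : ℝ) ^ (32 * 96)) ^ a := by positivity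
  have hlt : (8 : ℝ) ^ a * ((31 / 32 : ℝ) ^ 96) ^ a < 1 := by
    rw [← mul_pow]
    exact pow_lt_one₀ (by positivity) (by norm_num) ha.ne'
  nlinarith

/-! ### Traces of pebblings -/

/-- The vertices that are untouched at time `s` and completed at some time in `(s, b]`.
Here `W k` and `E k` are the sets of vertices touched and completed at time `k`. -/
def Fresh {V : Type} (W E : ℕ → Set V) (s b : ℕ) : Set V :=
  {v | v ∉ W s ∧ ∃ k, s < k ∧ k ≤ b ∧ v ∈ E k}

/-- An abstract record of a pebbling in which completing a vertex may take several steps: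
`W k` and `E k` are the sets of vertices that are touched and completed at time `k`.
The only legality requirement is that a predecessor of a freshly completed vertex was touched
at the beginning of the interval or is itself freshly completed. -/
structure IsTrace {V : Type} (adj : V → V → Prop) (t : ℕ) (W E : ℕ → Set V) : Prop where
  /-- A completed vertex is touched. -/
  subset : ∀ k, E k ⊆ W k
  /-- Completing a vertex from scratch requires its predecessors. -/
  pred : ∀ s b, b ≤ t → ∀ u v, adj u v → v ∈ Fresh W E s b → u ∈ W s ∪ Fresh W E s b

section Trace

variable {V : Type} {adj : V → V → Prop} {t : ℕ} {W E : ℕ → Set V}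

theorem IsTrace.comap {V' : Type} {adj' : V' → V' → Prop} (h : IsTrace adj t W E) (c : V' → V)
    (hc : ∀ u v, adj' u v → adj (c u) (c v)) :
    IsTrace adj' t (fun k => c ⁻¹' W k) (fun k => c ⁻¹' E k) where
  subset k _ hx := h.subset k hx
  pred s b hb u v huv hv := h.pred s b hb (c u) (c v) (hc u v huv) hv

theorem ncard_preimage_le [Finite V] {Y : Type} {q : Y → V} (hq : q.Injective) (A : Set V) :
    (q ⁻¹' A).ncard ≤ A.ncard :=
  Set.ncard_le_ncard_of_injOn q (fun _ h => h) hq.injOn A.toFinite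

theorem ncard_fresh_le_of_le [Finite V] {Y : Type} [Finite Y] {q : Y → V} (hq : q.Injective)
    {w s b : ℕ} (hws : w ≤ s) :
    (q ⁻¹' Fresh W E s b).ncard ≤ (q ⁻¹' Fresh W E w b).ncard + (W w).ncard := by
  have hsub : q ⁻¹' Fresh W E s b ⊆ q ⁻¹' Fresh W E w b ∪ q ⁻¹' W w := by
    rintro x ⟨_, k, hk, hkb, hE⟩
    by_cases hx : q x ∈ W w
    · exact Or.inr hx
    · exact Or.inl ⟨hx, k, by omega, hkb, hE⟩
  have h1 := Set.ncard_le_ncard hsub (Set.toFinite _)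
  have h2 := Set.ncard_union_le (q ⁻¹' Fresh W E w b) (q ⁻¹' W w)
  have h3 := ncard_preimage_le hq (W w)
  omega

theorem IsTrace.ncard_fresh_split [Finite V] (h : IsTrace adj t W E) {Y : Type} [Finite Y]
    {q : Y → V} (hq : q.Injective) (s w b : ℕ) :
    (q ⁻¹' Fresh W E s b).ncard ≤
      (q ⁻¹' Fresh W E s (w - 1)).ncard + (W w).ncard + (q ⁻¹' Fresh W E w b).ncard := by
  have hsub : q ⁻¹' Fresh W E s b ⊆
      (q ⁻¹' Fresh W E s (w - 1) ∪ q ⁻¹' W w) ∪ q ⁻¹' Fresh W E w b := by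
    rintro x ⟨hs, k, hk, hkb, hE⟩
    by_cases hx : q x ∈ W w
    · exact Or.inl (Or.inr hx)
    · rcases lt_trichotomy k w with hkw | rfl | hkw
      · exact Or.inl (Or.inl ⟨hs, k, hk, by omega, hE⟩)
      · exact absurd (h.subset k hE) hx
      · exact Or.inr ⟨hx, k, hkw, hkb, hE⟩
  have h1 := Set.ncard_le_ncard hsub (Set.toFinite _)
  have h2 := Set.ncard_union_le (q ⁻¹' Fresh W E s (w - 1) ∪ q ⁻¹' W w) (q ⁻¹' Fresh W E w b)
  have h3 := Set.ncard_union_le (q ⁻¹' Fresh W E s (w - 1)) (q ⁻¹' W w)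
  have h4 := ncard_preimage_le hq (W w)
  omega

/-- Freshly completing a `1/32` fraction of a layer that is fed by a disperser forces almost all
vertices of the feeding layer to be freshly completed. -/
theorem IsTrace.disperser [Finite V] (h : IsTrace adj t W E) {a b d : ℕ}
    {f : Fin a → Fin d → Fin b} (hf : IsDisperser f) {p : Fin b → V} (hp : p.Injective)
    {q : Fin a → V} (hadj : ∀ y j, adj (p (f y j)) (q y)) {s e : ℕ} (he : e ≤ t)
    (hq : a ≤ 32 * (q ⁻¹' Fresh W E s e).ncard) :
    31 * b < 32 * (W s).ncard + 32 * (p ⁻¹' Fresh W E s e).ncard := by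
  by_contra! hcon
  have h2 := Set.ncard_union_le (p ⁻¹' W s) (p ⁻¹' Fresh W E s e)
  have h3 := ncard_preimage_le hp (W s)
  have h4 := Set.ncard_add_ncard_compl (p ⁻¹' W s ∪ p ⁻¹' Fresh W E s e)
  rw [Nat.card_fin] at h4
  obtain ⟨y, hy, j, hj⟩ := hf (q ⁻¹' Fresh W E s e) (p ⁻¹' W s ∪ p ⁻¹' Fresh W E s e)ᶜ hq
    (by omega)
  exact hj (h.pred s e he _ _ (hadj y j) hy)

/-- The step that locates sparse times. Suppose that no interval of times with at least `N / 32`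
touched vertices throughout has `N` freshly completed vertices in the layer `p` of size `2 * N`,
and that a disperser feeds the layer `q` from `p`. If many vertices of `q` are freshly completed
during `(x, y]`, then this interval contains a time `w` with fewer than `N / 32` touched vertices,
after which almost as many vertices of `q` are freshly completed. -/
theorem IsTrace.exists_sparse [Finite V] (h : IsTrace adj t W E) {N a d : ℕ}
    {f : Fin a → Fin d → Fin (2 * N)} (hf : IsDisperser f) {p : Fin (2 * N) → V}
    (hp : p.Injective) {q : Fin a → V} (hq : q.Injective)
    (hadj : ∀ y j, adj (p (f y j)) (q y)) {s b : ℕ} (hb : b ≤ t)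
    (hfew : ∀ s' b', s ≤ s' → s' ≤ b' → b' ≤ b →
      (∀ k, s' < k → k ≤ b' → N ≤ 32 * (W k).ncard) → (p ⁻¹' Fresh W E s' b').ncard < N)
    {z x y : ℕ} (hsz : s ≤ z) (hzx : z ≤ x) (hyb : y ≤ b) (hxy : x ≤ y)
    (hz : 16 * (W z).ncard ≤ N)
    (hmany : a + 2 * N ≤ 32 * (q ⁻¹' Fresh W E x y).ncard) :
    ∃ w, x < w ∧ w ≤ y ∧ 32 * (W w).ncard < N ∧
      32 * (q ⁻¹' Fresh W E x y).ncard ≤ a + 3 * N + 32 * (q ⁻¹' Fresh W E w y).ncard := by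
  classical
  -- `z₀` is the last time up to `x` with at most `N / 16` touched vertices.
  let z₀ := Nat.findGreatest (fun k => 16 * (W k).ncard ≤ N) x
  have hz₀ : 16 * (W z₀).ncard ≤ N :=
    Nat.findGreatest_spec (P := fun k => 16 * (W k).ncard ≤ N) hzx hz
  have hz₀x : z₀ ≤ x := Nat.findGreatest_le x
  have hzz₀ : z ≤ z₀ := Nat.le_findGreatest hzx hz
  have hafter : ∀ k, z₀ < k → k ≤ x → N ≤ 32 * (W k).ncard := by
    intro k hk hkx
    have := Nat.findGreatest_is_greatest hk hkx
    omega
  have key : ∀ e, x ≤ e → e ≤ y → (∀ k, x < k → k ≤ e → N ≤ 32 * (W k).ncard) →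
      32 * (q ⁻¹' Fresh W E x e).ncard < a + 2 * N := by
    intro e hxe hey hdense
    have h1 := ncard_fresh_le_of_le (W := W) (E := E) (b := e) hq hz₀x
    have h2 := hfew z₀ e (by omega) (by omega) (by omega) fun k hk hke =>
      (le_total k x).elim (hafter k hk) fun hxk => by
        rcases hxk.eq_or_lt with rfl | hxk
        · exact hafter _ hk le_rfl
        · exact hdense k hxk hke
    by_contra! hcon
    have h3 := h.disperser hf hp hadj (s := z₀) (e := e) (by omega) (by omega)
    omega
  by_cases hex : ∃ w, x < w ∧ w ≤ y ∧ 32 * (W w).ncard < N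
  · obtain ⟨hxw, hwy, hw⟩ := Nat.find_spec hex
    refine ⟨Nat.find hex, hxw, hwy, hw, ?_⟩
    have h1 := key (Nat.find hex - 1) (by omega) (by omega) fun k hk hk' => by
      have := Nat.find_min hex (m := k) (by omega)
      by_contra! hlt
      exact this ⟨hk, by omega, hlt⟩
    have h2 := h.ncard_fresh_split hq x (Nat.find hex) y
    omega
  · push Not at hex
    have := key y hxy le_rfl hex
    omega

end Trace

/-! ### The recursive networks -/

/-- A network with `N` inputs `src` and `N` outputs `snk`, of in-degree at most `D`.
The property `interval` is the time-space statement that is carried through the recursion. -/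
structure IsNet {V : Type} (D N : ℕ) (adj : V → V → Prop) (src snk : Fin N → V) : Prop where
  finite : Finite V
  acyclic : ∃ ρ : V → ℕ, ∀ u v, adj u v → ρ u < ρ v
  indegree : ∀ v, {u | adj u v}.ncard ≤ D
  src_injective : src.Injective
  snk_injective : snk.Injective
  source_iff : ∀ v, (∀ u, ¬ adj u v) ↔ v ∈ Set.range src
  /-- If few vertices are touched at time `s` and an eighth of the outputs are freshly completed
  during `(s, b]`, then within some subinterval half of the inputs are freshly completed
  while `N / 64` vertices are touched at all times. -/
  interval : ∀ (t : ℕ) (W E : ℕ → Set V), IsTrace adj t W E → ∀ s b, s ≤ b → b ≤ t →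
    32 * (W s).ncard ≤ N → N ≤ 8 * (snk ⁻¹' Fresh W E s b).ncard →
    ∃ s' b', s ≤ s' ∧ s' ≤ b' ∧ b' ≤ b ∧ N ≤ 2 * (src ⁻¹' Fresh W E s' b').ncard ∧
      ∀ k, s' < k → k ≤ b' → N ≤ 64 * (W k).ncard

/-- A single vertex is a network with one input and one output. -/
theorem isNet_one (D : ℕ) : IsNet D 1 (fun _ _ : Unit => False) (fun _ => ()) (fun _ => ()) where
  finite := inferInstance
  acyclic := ⟨fun _ => 0, fun _ _ h => h.elim⟩
  indegree _ := by simp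
  src_injective _ _ _ := Subsingleton.elim _ _
  snk_injective _ _ _ := Subsingleton.elim _ _
  source_iff v := by simp
  interval t W E h s b _ _ _ hsnk := by
    classical
    have hne : ((fun _ : Fin 1 => ()) ⁻¹' Fresh W E s b).Nonempty :=
      Set.nonempty_of_ncard_ne_zero (by omega)
    obtain ⟨_, hs, k, hk, hkb, hE⟩ := hne
    simp only at hs hE
    -- `z` is the last time before `k` at which the vertex is untouched.
    let z := Nat.findGreatest (fun k => () ∉ W k) k
    have hz : () ∉ W z := Nat.findGreatest_spec (P := fun k => () ∉ W k) hk.le hs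
    have hsz : s ≤ z := Nat.le_findGreatest hk.le hs
    have hzk : z ≤ k := Nat.findGreatest_le k
    have hzk' : z ≠ k := fun hzk => hz (hzk ▸ h.subset k hE)
    refine ⟨z, k, hsz, hzk, hkb, ?_, fun l hl hlk => ?_⟩
    · have : 0 < ((fun _ : Fin 1 => ()) ⁻¹' Fresh W E z k).ncard :=
        (Set.ncard_pos (Set.toFinite _)).2 ⟨0, hz, k, by omega, le_rfl, hE⟩
      omega
    · have : 0 < (W l).ncard :=
        (Set.ncard_pos (Set.toFinite _)).2
          ⟨(), not_not.1 (Nat.findGreatest_is_greatest hl hlk)⟩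
      omega

/-- The edges of the network that stacks two copies `inr (false, ·)` and `inr (true, ·)` of a
network between a layer of inputs `inl (false, ·)` and a layer of outputs `inl (true, ·)`. The
inputs feed the outputs and the inputs of both copies, the outputs of the first copy are matched
with the inputs of the second, and the outputs of the second copy feed the outputs. -/
inductive StackAdj {V : Type} {M N d : ℕ} (adj : V → V → Prop) (src snk : Fin N → V)
    (f : Fin M → Fin d → Fin M) (g : Fin N → Fin d → Fin M) (h : Fin M → Fin d → Fin N) :
    (Bool × Fin M) ⊕ (Bool × V) → (Bool × Fin M) ⊕ (Bool × V) → Prop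
  | copy (c : Bool) (u v : V) : adj u v → StackAdj adj src snk f g h (.inr (c, u)) (.inr (c, v))
  | across (y : Fin M) (j : Fin d) :
      StackAdj adj src snk f g h (.inl (false, f y j)) (.inl (true, y))
  | enter (c : Bool) (x : Fin N) (j : Fin d) :
      StackAdj adj src snk f g h (.inl (false, g x j)) (.inr (c, src x))
  | link (x : Fin N) : StackAdj adj src snk f g h (.inr (false, snk x)) (.inr (true, src x))
  | exit (y : Fin M) (j : Fin d) :
      StackAdj adj src snk f g h (.inr (true, snk (h y j))) (.inl (true, y))

section Stack

variable {V : Type} {N d D : ℕ} {adj : V → V → Prop} {src snk : Fin N → V}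
  {f : Fin (2 * N) → Fin d → Fin (2 * N)} {g : Fin N → Fin d → Fin (2 * N)}
  {h : Fin (2 * N) → Fin d → Fin N}

theorem inr_injective {A : Type} (c : Bool) :
    Function.Injective fun v : V => (Sum.inr (c, v) : A ⊕ (Bool × V)) :=
  fun _ _ huv => by simpa using huv

theorem ncard_copies_le {A : Type} [Finite V] [Finite A] (X : Set (A ⊕ (Bool × V))) :
    ((fun v : V => (Sum.inr (false, v) : A ⊕ (Bool × V))) ⁻¹' X).ncard +
      ((fun v : V => (Sum.inr (true, v) : A ⊕ (Bool × V))) ⁻¹' X).ncard ≤ X.ncard := by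
  rw [← Set.ncard_image_of_injective (_ ⁻¹' X) (inr_injective (V := V) (A := A) false),
    ← Set.ncard_image_of_injective ((fun v : V => (Sum.inr (true, v) : A ⊕ (Bool × V))) ⁻¹' X)
      (inr_injective (V := V) (A := A) true), ← Set.ncard_union_eq]
  · refine Set.ncard_le_ncard ?_ (Set.toFinite _)
    rintro _ (⟨v, hv, rfl⟩ | ⟨v, hv, rfl⟩) <;> exact hv
  · rw [Set.disjoint_left]
    rintro _ ⟨v, _, rfl⟩ ⟨v', _, hv'⟩
    simp at hv'

theorem StackAdj.exists_rank [Finite V] (hadj : ∃ ρ : V → ℕ, ∀ u v, adj u v → ρ u < ρ v) :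
    ∃ ρ : (Bool × Fin (2 * N)) ⊕ (Bool × V) → ℕ,
      ∀ u v, StackAdj adj src snk f g h u v → ρ u < ρ v := by
  obtain ⟨ρ, hρ⟩ := hadj
  obtain ⟨m, hm⟩ := (Set.finite_range ρ).bddAbove
  have hm' : ∀ v, ρ v ≤ m := fun v => hm ⟨v, rfl⟩
  refine ⟨Sum.elim (fun x => if x.1 then 2 * m + 3 else 0)
    fun v => ρ v.2 + 1 + if v.1 then m + 1 else 0, fun u v huv => ?_⟩
  cases huv with
  | copy c u v huv => simpa using hρ u v huv
  | across y j => simp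
  | enter c x j => simp
  | link x =>
    have := hm' (snk x)
    simp
    omega
  | exit y j =>
    have := hm' (snk (h y j))
    simp
    omega

theorem ncard_range_fin_le {A : Type} (φ : Fin d → A) : (Set.range φ).ncard ≤ d := by
  rw [← Set.image_univ]
  exact (Set.ncard_image_le (Set.toFinite _)).trans (by simp)

theorem StackAdj.ncard_le [Finite V] (hd : 0 < d) (hsrc : src.Injective)
    (hdeg : ∀ v, {u | adj u v}.ncard ≤ 2 * d)
    (hsource : ∀ v, (∀ u, ¬ adj u v) ↔ v ∈ Set.range src) (v) :
    {u | StackAdj adj src snk f g h u v}.ncard ≤ 2 * d := by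
  rcases v with ⟨c, y⟩ | ⟨c, v⟩
  · have hsub : {u | StackAdj adj src snk f g h u (.inl (c, y))} ⊆
        (Set.range fun j => .inl (false, f y j)) ∪
          Set.range fun j => .inr (true, snk (h y j)) := by
      intro u hu
      cases hu with
      | across y j => exact Or.inl ⟨j, rfl⟩
      | exit y j => exact Or.inr ⟨j, rfl⟩
    refine (Set.ncard_le_ncard hsub (Set.toFinite _)).trans ((Set.ncard_union_le _ _).trans ?_)
    exact (add_le_add (ncard_range_fin_le _) (ncard_range_fin_le _)).trans_eq (two_mul d).symm
  · by_cases hv : v ∈ Set.range src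
    · have hno := (hsource v).2 hv
      obtain ⟨x, rfl⟩ := hv
      have hsub : {u | StackAdj adj src snk f g h u (.inr (c, src x))} ⊆
          (Set.range fun j => .inl (false, g x j)) ∪ {.inr (false, snk x)} := by
        intro u hu
        rw [Set.mem_ofPred_eq] at hu
        generalize hw : src x = w at hu
        cases hu with
        | copy c u v huv => exact absurd huv (hw ▸ hno u)
        | enter c x' j => exact Or.inl ⟨j, by rw [hsrc hw]⟩
        | link x' => exact Or.inr (by rw [hsrc hw]; rfl)
      refine (Set.ncard_le_ncard hsub (Set.toFinite _)).trans ((Set.ncard_union_le _ _).trans ?_)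
      rw [Set.ncard_singleton]
      exact (add_le_add (ncard_range_fin_le _) hd).trans_eq (two_mul d).symm
    · have hsub : {u | StackAdj adj src snk f g h u (.inr (c, v))} ⊆
          (fun u => .inr (c, u)) '' {u | adj u v} := by
        intro u hu
        cases hu with
        | copy c u v huv => exact ⟨u, huv, rfl⟩
        | enter c x j => exact absurd ⟨x, rfl⟩ hv
        | link x => exact absurd ⟨x, rfl⟩ hv
      exact (Set.ncard_le_ncard hsub (Set.toFinite _)).trans
        ((Set.ncard_image_le (Set.toFinite _)).trans (hdeg v))

theorem StackAdj.source_iff (hd : 0 < d)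
    (hsource : ∀ v, (∀ u, ¬ adj u v) ↔ v ∈ Set.range src) (v) :
    (∀ u, ¬ StackAdj adj src snk f g h u v) ↔
      v ∈ Set.range fun x : Fin (2 * N) =>
        (.inl (false, x) : (Bool × Fin (2 * N)) ⊕ (Bool × V)) := by
  constructor
  · intro hv
    rcases v with ⟨_ | _, y⟩ | ⟨c, v⟩
    · exact ⟨y, rfl⟩
    · exact absurd (StackAdj.across y ⟨0, hd⟩) (hv _)
    · obtain ⟨x, rfl⟩ := (hsource v).1 fun u hu => hv _ (StackAdj.copy c u v hu)
      exact absurd (StackAdj.enter c x ⟨0, hd⟩) (hv _)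
  · rintro ⟨x, rfl⟩ u hu
    cases hu

/-- Stacking two copies of a network doubles the number of vertices that stay touched: within an
interval in which the second copy is crowded, a sparse time is found from which the first copy
has to be traversed again, which gives a subinterval in which both copies are crowded. -/
theorem IsNet.stack (hnet : IsNet (2 * d) N adj src snk) (hN : 0 < N) (hd : 0 < d)
    (hf : IsDisperser f) (hg : IsDisperser g) (hh : IsDisperser h) :
    IsNet (2 * d) (2 * N) (StackAdj adj src snk f g h)
      (fun x => .inl (false, x)) (fun x => .inl (true, x)) where
  finite := by
    have := hnet.finite
    infer_instance
  acyclic := by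
    have := hnet.finite
    exact StackAdj.exists_rank hnet.acyclic
  indegree := by
    have := hnet.finite
    exact StackAdj.ncard_le hd hnet.src_injective hnet.indegree hnet.source_iff
  src_injective _ _ hxy := by simpa using hxy
  snk_injective _ _ hxy := by simpa using hxy
  source_iff := StackAdj.source_iff hd hnet.source_iff
  interval t W E htr s b hsb hbt hs hsnk := by
    have := hnet.finite
    by_contra! hcon
    let ι (c : Bool) (v : V) : (Bool × Fin (2 * N)) ⊕ (Bool × V) := .inr (c, v)
    have hι (c : Bool) : (ι c).Injective := inr_injective c
    let S (x : Fin (2 * N)) : (Bool × Fin (2 * N)) ⊕ (Bool × V) := .inl (false, x)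
    let T (x : Fin (2 * N)) : (Bool × Fin (2 * N)) ⊕ (Bool × V) := .inl (true, x)
    have hS : S.Injective := fun _ _ hxy => by simpa [S] using hxy
    have hT : T.Injective := fun _ _ hxy => by simpa [T] using hxy
    have hsrc (c : Bool) : (ι c ∘ src).Injective := (hι c).comp hnet.src_injective
    have hsnk' (c : Bool) : (ι c ∘ snk).Injective := (hι c).comp hnet.snk_injective
    have htrc (c : Bool) : IsTrace adj t (fun k => ι c ⁻¹' W k) (fun k => ι c ⁻¹' E k) :=
      htr.comap (ι c) fun u v huv => StackAdj.copy c u v huv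
    have hfew : ∀ s' b', s ≤ s' → s' ≤ b' → b' ≤ b →
        (∀ k, s' < k → k ≤ b' → N ≤ 32 * (W k).ncard) →
        (S ⁻¹' Fresh W E s' b').ncard < N := by
      intro s' b' h1 h2 h3 h4
      by_contra! h5
      obtain ⟨k, hk, hkb, hlt⟩ := hcon s' b' h1 h2 h3 (Nat.mul_le_mul_left 2 h5)
      have := h4 k hk hkb
      omega
    -- A sparse time after which most of the outputs of the second copy are completed.
    obtain ⟨w, hsw, hwb, hw, hTw⟩ := htr.exists_sparse hf hS hT
      (fun y j => StackAdj.across y j) hbt hfew le_rfl le_rfl le_rfl hsb (by omega)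
      (show 2 * N + 2 * N ≤ 32 * (T ⁻¹' Fresh W E s b).ncard by
        have : 2 * N ≤ 8 * (T ⁻¹' Fresh W E s b).ncard := hsnk
        omega)
    have hsnk2 := htr.disperser hh (hsnk' true) (q := T) (fun y j => StackAdj.exit y j) hbt
      (s := w) (by
        have : 2 * N ≤ 8 * (T ⁻¹' Fresh W E s b).ncard := hsnk
        omega)
    have hWw (c : Bool) := ncard_preimage_le (hι c) (W w)
    obtain ⟨s₂, b₂, hws₂, hsb₂, hb₂, hsrc₂, hW₂⟩ := hnet.interval t _ _ (htrc true) w b hwb hbt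
      (by have := hWw true; omega)
      (show N ≤ 8 * ((ι true ∘ snk) ⁻¹' Fresh W E w b).ncard by omega)
    replace hsrc₂ : N ≤ 2 * ((ι true ∘ src) ⁻¹' Fresh W E s₂ b₂).ncard := hsrc₂
    -- A sparse time while the second copy is crowded.
    obtain ⟨w', hsw', hwb', hw', hsrcw'⟩ := htr.exists_sparse hg hS (hsrc true)
      (fun y j => StackAdj.enter true y j) hbt hfew (z := w) hsw.le hws₂ hb₂ hsb₂ (by omega)
      (by omega)
    have hlink : ((ι true ∘ src) ⁻¹' Fresh W E w' b₂).ncard ≤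
        (W w').ncard + ((ι false ∘ snk) ⁻¹' Fresh W E w' b₂).ncard := by
      have hsub : (ι true ∘ src) ⁻¹' Fresh W E w' b₂ ⊆
          (ι false ∘ snk) ⁻¹' W w' ∪ (ι false ∘ snk) ⁻¹' Fresh W E w' b₂ :=
        fun x hx => htr.pred w' b₂ (hb₂.trans hbt) _ _ (StackAdj.link x) hx
      have h1 := Set.ncard_le_ncard hsub (Set.toFinite _)
      have h2 := Set.ncard_union_le ((ι false ∘ snk) ⁻¹' W w')
        ((ι false ∘ snk) ⁻¹' Fresh W E w' b₂)
      have h3 := ncard_preimage_le (hsnk' false) (W w')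
      omega
    have hWw' := ncard_preimage_le (hι false) (W w')
    obtain ⟨s₁, b₁, hws₁, hsb₁, hb₁, hsrc₁, hW₁⟩ := hnet.interval t _ _ (htrc false) w' b₂ hwb'
      (hb₂.trans hbt) (by omega)
      (show N ≤ 8 * ((ι false ∘ snk) ⁻¹' Fresh W E w' b₂).ncard by omega)
    replace hsrc₁ : N ≤ 2 * ((ι false ∘ src) ⁻¹' Fresh W E s₁ b₁).ncard := hsrc₁
    -- Both copies are crowded now, so that no sparse time is left.
    obtain ⟨k, hk, hkb, hlt, -⟩ := htr.exists_sparse hg hS (hsrc false)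
      (fun y j => StackAdj.enter false y j) hbt hfew (z := w') (by omega) hws₁ (hb₁.trans hb₂)
      hsb₁ (by omega) (by omega)
    have h1 := hW₁ k hk hkb
    have h2 := hW₂ k (by omega) (by omega)
    have h3 := ncard_copies_le (W k)
    simp only [ι] at h1 h2
    omega

end Stack

/-- Networks with `2 ^ i` inputs and outputs, of bounded in-degree and with
`(2 * i + 1) * 2 ^ i` vertices. -/
theorem exists_isNet : ∃ d : ℕ, 0 < d ∧ ∀ i : ℕ, ∃ (V : Type) (adj : V → V → Prop)
    (src snk : Fin (2 ^ i) → V), IsNet (2 * d) (2 ^ i) adj src snk ∧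
      Nat.card V = (2 * i + 1) * 2 ^ i := by
  obtain ⟨d, hd, hdisp⟩ := exists_isDisperser
  refine ⟨d, hd, fun i => ?_⟩
  induction i with
  | zero => exact ⟨Unit, _, _, _, isNet_one _, by simp⟩
  | succ i ih =>
    obtain ⟨V, adj, src, snk, hnet, hcard⟩ := ih
    have := hnet.finite
    have hN : 0 < 2 ^ i := by positivity
    obtain ⟨f, hf⟩ := hdisp (2 * 2 ^ i) (2 * 2 ^ i) (by omega) (by omega) (by omega)
    obtain ⟨g, hg⟩ := hdisp (2 ^ i) (2 * 2 ^ i) (by omega) (by omega) (by omega)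
    obtain ⟨h, hh⟩ := hdisp (2 * 2 ^ i) (2 ^ i) (by omega) (by omega) (by omega)
    rw [pow_succ, mul_comm]
    refine ⟨_, _, _, _, hnet.stack hN hd hf hg hh, ?_⟩
    rw [Nat.card_sum, Nat.card_prod, Nat.card_prod, hcard, Nat.card_fin]
    simp only [Nat.card_eq_fintype_card, Fintype.card_bool]
    ring

/-! ### Pebblings of DAGs -/

theorem mem_parents {V : Type*} [Fintype V] {G : Digraph V} {u v : V} :
    u ∈ parents G v ↔ G.Adj u v := by
  simp [parents]

theorem isDAG_of_rank {V : Type*} {G : Digraph V} (ρ : V → ℕ)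
    (hρ : ∀ u v, G.Adj u v → ρ u < ρ v) : IsDAG G := by
  have key : ∀ u v, Relation.TransGen G.Adj u v → ρ u < ρ v := by
    intro u v huv
    induction huv with
    | single h => exact hρ _ _ h
    | tail _ h ih => exact ih.trans (hρ _ _ h)
  exact fun v hv => (key v v hv).false

section Pebbling

variable {V : Type*} [Fintype V] {G : Digraph V} {T : Finset V} {t : ℕ} {P : ℕ → Finset V}

theorem IsParallelPebblingOf.exists_parent_mem (hP : IsParallelPebblingOf G T t P) {s k : ℕ}
    {u v : V} (huv : G.Adj u v) (hs : v ∉ P s) (hsk : s ≤ k) (hkt : k ≤ t) (hk : v ∈ P k) :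
    ∃ l, s ≤ l ∧ l < k ∧ u ∈ P l := by
  induction k, hsk using Nat.le_induction with
  | base => exact absurd hk hs
  | succ m hsm ih =>
    by_cases hm : v ∈ P m
    · obtain ⟨l, h1, h2, h3⟩ := ih (by omega) hm
      exact ⟨l, h1, by omega, h3⟩
    · exact ⟨m, hsm, by omega, hP.legal (m + 1) (by omega) hkt v hk hm (mem_parents.2 huv)⟩

theorem IsDAG.exists_mem (hG : IsDAG G) (hP : IsParallelPebbling G t P) (v : V) :
    ∃ k ≤ t, v ∈ P k := by
  have : IsTrans V (flip (Relation.TransGen G.Adj)) := ⟨fun _ _ _ h1 h2 => h2.trans h1⟩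
  have : Std.Irrefl (flip (Relation.TransGen G.Adj)) := ⟨fun v => hG v⟩
  have hwf : WellFounded (flip (Relation.TransGen G.Adj)) :=
    Finite.wellFounded_of_trans_of_irrefl _
  induction v using hwf.induction with
  | _ v ih =>
    by_cases hv : ∃ u, G.Adj v u
    · obtain ⟨u, hvu⟩ := hv
      obtain ⟨k, hk, hu⟩ := ih u (Relation.TransGen.single hvu)
      obtain ⟨l, -, hl, hv⟩ :=
        hP.exists_parent_mem hvu (s := 0) (by simp [hP.start]) (Nat.zero_le k) hk hu
      exact ⟨l, by omega, hv⟩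
    · push Not at hv
      exact hP.complete v (by simpa [sinks] using hv)

/-- The first nonempty configuration consists of sources. -/
theorem IsDAG.exists_first_step [DecidableEq V] [Nonempty V] (hG : IsDAG G)
    (hP : IsParallelPebbling G t P) :
    ∃ i, 1 ≤ i ∧ i ≤ t ∧ 1 ≤ (sources G ∩ ((Finset.Icc i i).biUnion P \ P (i - 1))).card ∧
      1 ≤ (P i).card := by
  classical
  obtain ⟨k, hkt, hk⟩ := hG.exists_mem hP (Classical.arbitrary V)
  have hex : ∃ k, (P k).Nonempty := ⟨k, _, hk⟩
  obtain ⟨x, hx⟩ := Nat.find_spec hex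
  have hle : Nat.find hex ≤ k := Nat.find_min' hex ⟨_, hk⟩
  have hpos : 1 ≤ Nat.find hex := by
    rw [Nat.one_le_iff_ne_zero]
    intro h0
    rw [h0, hP.start] at hx
    simp at hx
  have hprev : P (Nat.find hex - 1) = ∅ :=
    Finset.not_nonempty_iff_eq_empty.1 (Nat.find_min hex (by omega))
  refine ⟨Nat.find hex, hpos, by omega, Finset.card_pos.2 ⟨x, ?_⟩, Finset.card_pos.2 ⟨x, hx⟩⟩
  have hpar := hP.legal _ hpos (by omega) x hx (by simp [hprev])
  rw [hprev, Finset.subset_empty] at hpar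
  simp [sources, hprev, hpar, hx]

end Pebbling

/-! ### Reduction of the in-degree -/

/-- Reduction of the in-degree to two: each vertex `v` becomes a directed path `(v, 0), (v, 1), …`
with `D` vertices, and the end of the path of the `j`-th predecessor of `v`, in the list `L v`, is
joined to `(v, j)`. -/
def chain {V : Type} (D : ℕ) (L : V → List V) : Digraph (V × Fin D) where
  Adj p q := (p.1 = q.1 ∧ p.2.val + 1 = q.2.val) ∨
    (p.2.val + 1 = D ∧ (L q.1)[q.2.val]? = some p.1)

section Chain

variable {V : Type} {D : ℕ} {L : V → List V} {adj : V → V → Prop}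

theorem chain_rank {ρ : V → ℕ} (hL : ∀ u v, u ∈ L v ↔ adj u v)
    (hρ : ∀ u v, adj u v → ρ u < ρ v) (p q : V × Fin D) (hpq : (chain D L).Adj p q) :
    ρ p.1 * D + p.2 < ρ q.1 * D + q.2 := by
  rcases hpq with ⟨h1, h2⟩ | ⟨-, h2⟩
  · rw [h1]
    omega
  · have h3 := hρ _ _ ((hL _ _).1 (List.mem_of_getElem? h2))
    have h4 : (ρ p.1 + 1) * D ≤ ρ q.1 * D := Nat.mul_le_mul_right D h3
    have h5 := p.2.isLt
    rw [add_mul] at h4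
    omega

theorem card_parents_chain_le [Fintype V] (q : V × Fin D) :
    (parents (chain D L) q).card ≤ 2 := by
  classical
  have hsub : parents (chain D L) q ⊆
      (Finset.univ.filter fun p : V × Fin D => p.1 = q.1 ∧ p.2.val + 1 = q.2.val) ∪
        Finset.univ.filter fun p : V × Fin D =>
          p.2.val + 1 = D ∧ (L q.1)[q.2.val]? = some p.1 := by
    intro p hp
    simpa [chain] using mem_parents.1 hp
  refine (Finset.card_le_card hsub).trans ((Finset.card_union_le _ _).trans ?_)
  refine Nat.add_le_add (b := 1) (d := 1) (Finset.card_le_one.2 ?_) (Finset.card_le_one.2 ?_)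
  · rintro p hp p' hp'
    simp only [Finset.mem_filter, Finset.mem_univ, true_and] at hp hp'
    exact Prod.ext (hp.1.trans hp'.1.symm) (Fin.ext (by omega))
  · rintro p hp p' hp'
    simp only [Finset.mem_filter, Finset.mem_univ, true_and] at hp hp'
    exact Prod.ext (Option.some_injective _ (hp.2.symm.trans hp'.2)) (Fin.ext (by omega))

theorem mem_sources_chain [Fintype V] (hL : ∀ u v, u ∈ L v ↔ adj u v) (q : V × Fin D) :
    q ∈ sources (chain D L) ↔ q.2.val = 0 ∧ ∀ u, ¬ adj u q.1 := by
  simp only [sources, Finset.mem_filter, Finset.mem_univ, true_and,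
    Finset.eq_empty_iff_forall_notMem, mem_parents]
  have hpos : 0 < D := q.2.pos
  constructor
  · intro hq
    have h0 : q.2.val = 0 := by
      by_contra h0
      exact hq (q.1, ⟨q.2.val - 1, by omega⟩) (Or.inl ⟨rfl, by simp; omega⟩)
    refine ⟨h0, fun u hu => ?_⟩
    have hne : 0 < (L q.1).length := List.length_pos_of_mem ((hL _ _).2 hu)
    refine hq ((L q.1)[0], ⟨D - 1, by omega⟩) (Or.inr ⟨by simp; omega, ?_⟩)
    rw [h0]
    simp [hne]
  · rintro ⟨h0, hno⟩ p (⟨-, h⟩ | ⟨-, h⟩)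
    · omega
    · exact hno _ ((hL _ _).1 (List.mem_of_getElem? h))

/-- A vertex counts as touched when its path carries a pebble, and as completed when the end of
its path carries one. -/
theorem IsParallelPebblingOf.isTrace [Fintype V] {T : Finset (V × Fin D)} {t : ℕ}
    {P : ℕ → Finset (V × Fin D)} (hP : IsParallelPebblingOf (chain D L) T t P)
    (hL : ∀ u v, u ∈ L v ↔ adj u v) (hlen : ∀ v, (L v).length ≤ D) :
    IsTrace adj t (fun k => {v | ∃ j, (v, j) ∈ P k})
      (fun k => {v | ∃ j : Fin D, j.val + 1 = D ∧ (v, j) ∈ P k}) where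
  subset k v := fun ⟨j, _, hj⟩ => ⟨j, hj⟩
  pred s b hb u v huv hv := by
    obtain ⟨hs, k, hsk, hkb, l, hl, hk⟩ := hv
    have hs' : ∀ j, (v, j) ∉ P s := fun j hj => hs ⟨j, hj⟩
    -- Every vertex of the path of `v` carries a pebble at some time in `(s, b]`.
    have hpath : ∀ m (j : Fin D), j.val + 1 + m = D → ∃ k, s < k ∧ k ≤ b ∧ (v, j) ∈ P k := by
      intro m
      induction m with
      | zero =>
        intro j hj
        obtain rfl : j = l := Fin.ext (by omega)
        exact ⟨k, hsk, hkb, hk⟩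
      | succ m ih =>
        intro j hj
        obtain ⟨k, hsk, hkb, hk⟩ := ih ⟨j.val + 1, by omega⟩ (by simp; omega)
        obtain ⟨k', hsk', hk'k, hk'⟩ := hP.exists_parent_mem (u := (v, j))
          (v := (v, ⟨j.val + 1, by omega⟩)) (Or.inl ⟨rfl, rfl⟩)
          (hs' _) hsk.le (hkb.trans hb) hk
        have : k' ≠ s := fun h => hs' j (h ▸ hk')
        exact ⟨k', by omega, by omega, hk'⟩
    obtain ⟨i, hi, hiu⟩ := List.getElem_of_mem ((hL u v).2 huv)
    have hiD : i < D := hi.trans_le (hlen v)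
    obtain ⟨k', hsk', hkb', hk'⟩ := hpath (D - 1 - i) ⟨i, hiD⟩ (by simp; omega)
    obtain ⟨k'', hsk'', hk'', hu⟩ := hP.exists_parent_mem (u := (u, l))
      (Or.inr ⟨hl, by simp [hi, hiu]⟩) (hs' _) hsk'.le (hkb'.trans hb) hk'
    by_cases hus : ∃ j, (u, j) ∈ P s
    · exact Or.inl hus
    · have : k'' ≠ s := fun h => hus ⟨l, h ▸ hu⟩
      exact Or.inr ⟨hus, k'', by omega, by omega, l, hl, hu⟩

theorem ncard_touched_le (Q : Finset (V × Fin D)) : {v | ∃ j, (v, j) ∈ Q}.ncard ≤ Q.card := by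
  classical
  have : {v | ∃ j, (v, j) ∈ Q} = ((Q.image Prod.fst : Finset V) : Set V) := by
    ext v
    simp
  rw [this, Set.ncard_coe_finset]
  exact Finset.card_image_le

/-- In every pebbling of the reduced network that reaches all vertices, half of the sources
are repebbled within an interval in which many pebbles are present throughout. -/
theorem IsNet.exists_interval_chain [Fintype V] [DecidableEq V] {N : ℕ} {src snk : Fin N → V}
    (hnet : IsNet D N adj src snk) (hN : 0 < N) (hD : 0 < D) {T : Finset (V × Fin D)} {t : ℕ}
    {P : ℕ → Finset (V × Fin D)} (hP : IsParallelPebblingOf (chain D L) T t P)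
    (hall : ∀ q, ∃ k ≤ t, q ∈ P k)
    (hL : ∀ u v, u ∈ L v ↔ adj u v) (hlen : ∀ v, (L v).length ≤ D) :
    ∃ i j, 1 ≤ i ∧ i ≤ j ∧ j ≤ t ∧
      N ≤ 2 * (sources (chain D L) ∩ ((Finset.Icc i j).biUnion P \ P (i - 1))).card ∧
      ∀ k, i ≤ k → k ≤ j → N ≤ 64 * (P k).card := by
  set W : ℕ → Set V := fun k => {v | ∃ j, (v, j) ∈ P k} with hW
  set E : ℕ → Set V := fun k => {v | ∃ j : Fin D, j.val + 1 = D ∧ (v, j) ∈ P k} with hE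
  have htr : IsTrace adj t W E := hP.isTrace hL hlen
  have hW0 : W 0 = ∅ := by
    simp [hW, hP.start]
  have hfresh : snk ⁻¹' Fresh W E 0 t = Set.univ := by
    refine Set.eq_univ_of_forall fun x => ⟨by simp [hW0], ?_⟩
    obtain ⟨k, hk, hx⟩ := hall (snk x, ⟨D - 1, by omega⟩)
    refine ⟨k, Nat.pos_of_ne_zero ?_, hk, ⟨D - 1, by omega⟩, by simp; omega, hx⟩
    rintro rfl
    simp [hP.start] at hx
  obtain ⟨s, b, -, hsb, hbt, hsrc, hmany⟩ := hnet.interval t W E htr 0 t (Nat.zero_le t) le_rfl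
    (by simp [hW0]) (by rw [hfresh, Set.ncard_univ, Nat.card_fin]; omega)
  obtain ⟨x₀, -, k₀, hk₀, hk₀b, -⟩ : (src ⁻¹' Fresh W E s b).Nonempty :=
    Set.nonempty_of_ncard_ne_zero (by omega)
  refine ⟨s + 1, b, by omega, by omega, hbt, hsrc.trans (Nat.mul_le_mul_left 2 ?_), ?_⟩
  · rw [← Set.ncard_coe_finset]
    refine Set.ncard_le_ncard_of_injOn (fun x => (src x, (⟨0, hD⟩ : Fin D))) ?_ ?_
      (Set.toFinite _)
    · rintro x ⟨hxs, k, hsk, hkb, l, hl, hk⟩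
      -- The path of a source is filled from its first vertex on.
      have hpath : ∀ m (hm : m < D), m ≤ l.val → ∃ k, s < k ∧ k ≤ b ∧
          (src x, (⟨l.val - m, by omega⟩ : Fin D)) ∈ P k := by
        intro m
        induction m with
        | zero => exact fun _ _ => ⟨k, hsk, hkb, hk⟩
        | succ m ih =>
          intro hm hml
          obtain ⟨k, hsk, hkb, hk⟩ := ih (by omega) (by omega)
          obtain ⟨k', hsk', hk'k, hk'⟩ := hP.exists_parent_mem
            (u := (src x, (⟨l.val - (m + 1), by omega⟩ : Fin D)))
            (v := (src x, (⟨l.val - m, by omega⟩ : Fin D))) (Or.inl ⟨rfl, by simp; omega⟩)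
            (fun h => hxs ⟨_, h⟩) hsk.le (hkb.trans hbt) hk
          have : k' ≠ s := fun h => hxs ⟨_, h ▸ hk'⟩
          exact ⟨k', by omega, by omega, hk'⟩
      obtain ⟨k', hsk', hkb', hk'⟩ := hpath l.val l.isLt le_rfl
      simp only [Nat.sub_self] at hk'
      simp only [Finset.coe_inter, Finset.coe_sdiff, Set.mem_inter_iff, Set.mem_sdiff,
        Finset.mem_coe, Finset.mem_biUnion, Finset.mem_Icc, add_tsub_cancel_right]
      refine ⟨(mem_sources_chain hL _).2 ⟨rfl, (hnet.source_iff _).2 ⟨x, rfl⟩⟩,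
        ⟨k', ⟨by omega, hkb'⟩, hk'⟩, fun h => hxs ⟨_, h⟩⟩
    · intro x _ y _ hxy
      exact hnet.src_injective (Prod.ext_iff.1 hxy).1
  · intro k hk hkb
    have h1 := hmany k (by omega) hkb
    have h2 := ncard_touched_le (P k)
    simp only [hW] at h1
    omega

theorem IsNet.card_sources_chain [Fintype V] {N : ℕ} {src snk : Fin N → V}
    (hnet : IsNet D N adj src snk) (hL : ∀ u v, u ∈ L v ↔ adj u v) :
    (sources (chain D L)).card ≤ N := by
  classical
  have hmaps : ∀ q ∈ sources (chain D L), q.1 ∈ Finset.univ.image src := by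
    intro q hq
    simpa using (hnet.source_iff _).1 ((mem_sources_chain hL q).1 hq).2
  refine (Finset.card_le_card_of_injOn Prod.fst hmaps ?_).trans
    (Finset.card_image_le.trans (by simp))
  intro p hp q hq hpq
  have h1 := ((mem_sources_chain hL p).1 hp).1
  have h2 := ((mem_sources_chain hL q).1 hq).1
  exact Prod.ext hpq (Fin.ext (by omega))

end Chain

/-! ### Padding -/

/-- The extension of a digraph along an embedding: every vertex outside the image gets the two
parents `e w₀` and `e w₁`. -/
def pad {V U : Type} (H : Digraph V) (e : V ↪ U) (w₀ w₁ : V) : Digraph U where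
  Adj a b := (∃ u v, e u = a ∧ e v = b ∧ H.Adj u v) ∨
    (b ∉ Set.range e ∧ (a = e w₀ ∨ a = e w₁))

section Pad

variable {V U : Type} {H : Digraph V} {e : V ↪ U} {w₀ w₁ : V}

theorem pad_adj_left {a : U} {v : V} :
    (pad H e w₀ w₁).Adj a (e v) ↔ ∃ u, e u = a ∧ H.Adj u v := by
  simp [pad]

theorem pad_adj_right {a b : U} (hb : b ∉ Set.range e) :
    (pad H e w₀ w₁).Adj a b ↔ a = e w₀ ∨ a = e w₁ := by
  have : ∀ v, e v ≠ b := fun v hv => hb ⟨v, hv⟩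
  simp [pad, this]

theorem isDAG_pad [Finite V] {ρ : V → ℕ} (hρ : ∀ u v, H.Adj u v → ρ u < ρ v) :
    IsDAG (pad H e w₀ w₁) := by
  obtain ⟨m, hm⟩ := (Set.finite_range ρ).bddAbove
  refine isDAG_of_rank (Function.extend e ρ fun _ => m + 1) fun a b hab => ?_
  by_cases hb : b ∈ Set.range e
  · obtain ⟨v, rfl⟩ := hb
    obtain ⟨u, rfl, huv⟩ := pad_adj_left.1 hab
    simpa [e.injective.extend_apply] using hρ u v huv
  · rw [Function.extend_apply' _ _ _ hb]
    rcases (pad_adj_right hb).1 hab with rfl | rfl <;>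
      rw [e.injective.extend_apply] <;> exact Nat.lt_succ_of_le (hm ⟨_, rfl⟩)

theorem parents_pad_of_notMem [Fintype U] [DecidableEq U] {b : U} (hb : b ∉ Set.range e) :
    parents (pad H e w₀ w₁) b = {e w₀, e w₁} := by
  ext a
  simp [mem_parents, pad_adj_right hb]

theorem parents_pad_apply [Fintype V] [Fintype U] (v : V) :
    parents (pad H e w₀ w₁) (e v) = (parents H v).map e := by
  ext a
  simp [mem_parents, pad_adj_left, and_comm]

theorem indeg_pad [Fintype V] [Fintype U] (hH : ∀ v, (parents H v).card ≤ 2) (hw : w₀ ≠ w₁)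
    (hlt : Fintype.card V < Fintype.card U) : indeg (pad H e w₀ w₁) = 2 := by
  classical
  have hout : ∀ b ∉ Set.range e, (parents (pad H e w₀ w₁) b).card = 2 := fun b hb => by
    rw [parents_pad_of_notMem hb, Finset.card_pair (e.injective.ne hw)]
  refine le_antisymm (Finset.sup_le fun b _ => ?_) ?_
  · by_cases hb : b ∈ Set.range e
    · obtain ⟨v, rfl⟩ := hb
      rw [parents_pad_apply, Finset.card_map]
      exact hH v
    · exact (hout b hb).le
  · obtain ⟨b, hb⟩ : ∃ b, b ∉ Set.range e := by
      by_contra! hsurj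
      exact absurd (Fintype.card_le_of_surjective e hsurj) (by omega)
    rw [← hout b hb]
    exact Finset.le_sup (f := fun v => (parents (pad H e w₀ w₁) v).card) (Finset.mem_univ b)

theorem sources_pad [Fintype V] [Fintype U] :
    sources (pad H e w₀ w₁) = (sources H).map e := by
  classical
  ext b
  by_cases hb : b ∈ Set.range e
  · obtain ⟨v, rfl⟩ := hb
    simp [sources, parents_pad_apply]
  · have hne : ∀ v, e v ≠ b := fun v hv => hb ⟨v, hv⟩
    simp [sources, parents_pad_of_notMem hb, hne]

/-- A pebbling of the extended digraph restricts to a legal pebbling of the original one. -/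
theorem IsParallelPebblingOf.restrict [Fintype V] [Fintype U] [DecidableEq U]
    {T : Finset U} {t : ℕ} {P : ℕ → Finset U} (hP : IsParallelPebblingOf (pad H e w₀ w₁) T t P) :
    IsParallelPebblingOf H ∅ t fun k => Finset.univ.filter fun v => e v ∈ P k where
  start := by simp [hP.start]
  complete := by simp
  legal i hi hit v hv hv' u hu := by
    simp only [Finset.mem_filter, Finset.mem_univ, true_and] at hv hv' ⊢
    refine hP.legal i hi hit (e v) hv hv' ?_
    rw [parents_pad_apply]
    exact Finset.mem_map_of_mem e hu

end Pad

/-! ### Graphs of every size -/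

/-- The graphs on `n` vertices that carry the network with `2 ^ i` sources. -/
theorem exists_digraph : ∃ D : ℕ, 0 < D ∧ ∀ i n : ℕ, D * ((2 * i + 1) * 2 ^ i) < n →
    ∃ G : Digraph (Fin n), IsDAG G ∧ indeg G = 2 ∧ (sources G).card ≤ 2 ^ i ∧
      ∀ t P, IsParallelPebbling G t P → ∃ i' j, 1 ≤ i' ∧ i' ≤ j ∧ j ≤ t ∧
        2 ^ i ≤ 2 * (sources G ∩ ((Finset.Icc i' j).biUnion P \ P (i' - 1))).card ∧
        ∀ k, i' ≤ k → k ≤ j → 2 ^ i ≤ 64 * (P k).card := by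
  classical
  obtain ⟨d, hd, hnets⟩ := exists_isNet
  refine ⟨2 * d, by omega, fun i n hn => ?_⟩
  obtain ⟨V, adj, src, snk, hnet, hcard⟩ := hnets i
  have := hnet.finite
  have := Fintype.ofFinite V
  let L (v : V) : List V := (Finset.univ.filter fun u => adj u v).toList
  have hL : ∀ u v, u ∈ L v ↔ adj u v := by simp [L]
  have hlen : ∀ v, (L v).length ≤ 2 * d := fun v => by
    have := hnet.indegree v
    rw [Set.ncard_eq_toFinset_card'] at this
    simpa [L] using this
  have hcard' : Fintype.card (V × Fin (2 * d)) < Fintype.card (Fin n) := by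
    rw [Fintype.card_prod, Fintype.card_fin, Fintype.card_fin, ← Nat.card_eq_fintype_card, hcard,
      mul_comm]
    exact hn
  obtain ⟨e⟩ := Function.Embedding.nonempty_of_card_le hcard'.le
  have hN : 0 < 2 ^ i := by positivity
  let v₀ : V := src ⟨0, hN⟩
  let w₀ : V × Fin (2 * d) := (v₀, ⟨0, by omega⟩)
  let w₁ : V × Fin (2 * d) := (v₀, ⟨1, by omega⟩)
  obtain ⟨ρ, hρ⟩ := hnet.acyclic
  have hDAG : IsDAG (pad (chain (2 * d) L) e w₀ w₁) := isDAG_pad (chain_rank hL hρ)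
  refine ⟨pad (chain (2 * d) L) e w₀ w₁, hDAG,
    indeg_pad card_parents_chain_le (by simp [w₀, w₁]) hcard', ?_, fun t P hP => ?_⟩
  · rw [sources_pad, Finset.card_map]
    exact hnet.card_sources_chain hL
  · obtain ⟨i', j, h1, h2, h3, h4, h5⟩ := hnet.exists_interval_chain hN (by omega)
      hP.restrict (fun q => by simpa using hDAG.exists_mem hP (e q)) hL hlen
    refine ⟨i', j, h1, h2, h3, h4.trans (Nat.mul_le_mul_left 2 ?_),
      fun k hk hkj => (h5 k hk hkj).trans (Nat.mul_le_mul_left 64 ?_)⟩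
    · refine Finset.card_le_card_of_injOn e ?_ e.injective.injOn
      intro q hq
      simpa [sources_pad] using hq
    · refine Finset.card_le_card_of_injOn e ?_ e.injective.injOn
      intro q hq
      simpa using hq

theorem exists_small_digraph (n : ℕ) :
    ∃ G : Digraph (Fin n), IsDAG G ∧ indeg G ≤ 2 ∧ (3 ≤ n → indeg G = 2) := by
  by_cases hn : 3 ≤ n
  · have hcard : Fintype.card (Fin 2) < Fintype.card (Fin n) := by simp; omega
    have hempty : ∀ v : Fin 2, (parents (⊥ : Digraph (Fin 2)) v).card ≤ 2 := fun v => by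
      simp [parents]
    have h := indeg_pad (e := Fin.castLEEmb (by omega : 2 ≤ n)) hempty zero_ne_one hcard
    exact ⟨_, isDAG_pad (ρ := fun _ => 0) (by simp), h.le, fun _ => h⟩
  · refine ⟨⊥, isDAG_of_rank (fun _ => 0) (by simp), ?_, fun h => absurd h hn⟩
    simp [indeg, parents]

/-- The exponent `i` for which the network with `2 ^ i` sources, of size of order `i * 2 ^ i`, has
size of order `n`, so that `2 ^ i` is of order `n / log n`. -/
theorem exists_scale {D n : ℕ} (hD : 0 < D) (hn : 3 ≤ n) (hDn : D < n) :
    ∃ i : ℕ, D * ((2 * i + 1) * 2 ^ i) < n ∧ (2 : ℝ) ^ i ≤ (D + 4) * n / Real.log n ∧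
      n / Real.log n ≤ 12 * D * (2 : ℝ) ^ i := by
  have hex : ∃ i : ℕ, n ≤ D * ((2 * (i + 1) + 1) * 2 ^ (i + 1)) := by
    refine ⟨n, ?_⟩
    calc n ≤ 2 ^ (n + 1) := (Nat.lt_two_pow_self.trans (Nat.pow_lt_pow_right (by norm_num)
          (Nat.lt_succ_self n))).le
      _ ≤ (2 * (n + 1) + 1) * 2 ^ (n + 1) := Nat.le_mul_of_pos_left _ (by omega)
      _ ≤ _ := Nat.le_mul_of_pos_left _ hD
  classical
  obtain ⟨i, hi, hupper⟩ : ∃ i, D * ((2 * i + 1) * 2 ^ i) < n ∧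
      n ≤ D * ((2 * (i + 1) + 1) * 2 ^ (i + 1)) := by
    refine ⟨Nat.find hex, ?_, Nat.find_spec hex⟩
    rcases h : Nat.find hex with _ | i
    · simpa using hDn
    · exact not_le.1 (Nat.find_min hex (by omega))
  have hnR : (3 : ℝ) ≤ n := by exact_mod_cast hn
  have hlog1 : 1 ≤ Real.log n := by
    rw [Real.le_log_iff_exp_le (by linarith)]
    linarith [Real.exp_one_lt_d9]
  have hDR : (1 : ℝ) ≤ D := by exact_mod_cast hD
  have hpow : (0 : ℝ) < 2 ^ i := by positivity
  have hlower' : (D : ℝ) * ((2 * i + 1) * 2 ^ i) ≤ n := by exact_mod_cast hi.le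
  have hupper' : (n : ℝ) ≤ D * ((2 * (i + 1) + 1) * 2 ^ (i + 1)) := by exact_mod_cast hupper
  refine ⟨i, hi, ?_, ?_⟩
  · rw [le_div_iff₀ (by linarith)]
    have hlog : Real.log n ≤ (D + 4) * (2 * i + 1) := by
      calc Real.log n ≤ Real.log (D * ((2 * (i + 1) + 1) * 2 ^ (i + 1))) :=
            Real.log_le_log (by linarith) hupper'
        _ = Real.log D + (Real.log (2 * (i + 1) + 1) + (i + 1) * Real.log 2) := by
            rw [Real.log_mul (by positivity) (by positivity),
              Real.log_mul (by positivity) (by positivity), Real.log_pow]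
            push_cast
            ring
        _ ≤ D + ((2 * (i + 1) + 1) + (i + 1) * 1) := by
            gcongr
            · exact Real.log_le_self (by positivity)
            · exact Real.log_le_self (by positivity)
            · linarith [Real.log_two_lt_d9]
        _ ≤ (D + 4) * (2 * i + 1) := by
            have : (0 : ℝ) ≤ D * i := by positivity
            have : (0 : ℝ) ≤ i := by positivity
            nlinarith
    calc (2 : ℝ) ^ i * Real.log n ≤ 2 ^ i * ((D + 4) * (2 * i + 1)) := by gcongr
      _ = (D + 4) * (1 * ((2 * i + 1) * 2 ^ i)) := by ring
      _ ≤ (D + 4) * (D * ((2 * i + 1) * 2 ^ i)) := by gcongr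
      _ ≤ (D + 4) * n := by gcongr
  · rw [div_le_iff₀ (by linarith)]
    have hlog : i * Real.log 2 ≤ Real.log n := by
      rw [← Real.log_pow]
      refine Real.log_le_log hpow (le_trans ?_ hlower')
      calc (2 : ℝ) ^ i = 1 * (1 * 2 ^ i) := by ring
        _ ≤ D * ((2 * i + 1) * 2 ^ i) := by
          gcongr
          linarith [(Nat.cast_nonneg i : (0 : ℝ) ≤ i)]
    have hi3 : (2 * (i + 1) + 1 : ℝ) ≤ 6 * Real.log n := by
      have := Real.log_two_gt_d9
      have : (0 : ℝ) ≤ i := by positivity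
      nlinarith
    calc (n : ℝ) ≤ D * ((2 * (i + 1) + 1) * 2 ^ (i + 1)) := hupper'
      _ ≤ D * ((6 * Real.log n) * 2 ^ (i + 1)) := by gcongr
      _ = 12 * D * 2 ^ i * Real.log n := by ring

/-- For each `n`, a graph with the required properties for constants that depend only on `D`. The
factor `768` is `12 * 64`, from `n / log n ≤ 12 * D * 2 ^ i` and the bound of `2 ^ i / 64` pebbles. -/
theorem exists_digraph_log : ∃ D : ℕ, 0 < D ∧ ∀ n : ℕ, ∃ G : Digraph (Fin n),
    IsDAG G ∧ indeg G ≤ 2 ∧ (3 ≤ n → indeg G = 2) ∧ (2 ≤ n →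
      ((sources G).card : ℝ) ≤ (D + 4) * n / Real.log n ∧
      ∀ t P, IsParallelPebbling G t P → ∃ i j, 1 ≤ i ∧ i ≤ j ∧ j ≤ t ∧
        1 / (768 * D) * n / Real.log n ≤
          ((sources G ∩ ((Finset.Icc i j).biUnion P \ P (i - 1))).card : ℝ) ∧
        ∀ k, i ≤ k → k ≤ j → 1 / (768 * D) * n / Real.log n ≤ ((P k).card : ℝ)) := by
  obtain ⟨D, hD, hgraph⟩ := exists_digraph
  refine ⟨D, hD, fun n => ?_⟩
  have hDR : (1 : ℝ) ≤ D := by exact_mod_cast hD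
  by_cases hn : 3 ≤ n ∧ D < n
  · obtain ⟨i, hi, hupper, hlower⟩ := exists_scale hD hn.1 hn.2
    obtain ⟨G, hDAG, hindeg, hsrc, hpeb⟩ := hgraph i n hi
    have hsmall : 1 / (768 * D) * n / Real.log n ≤ (2 : ℝ) ^ i / 64 := by
      calc 1 / (768 * D) * n / Real.log n = 1 / (768 * D) * (n / Real.log n) := by ring
        _ ≤ 1 / (768 * D) * (12 * D * (2 : ℝ) ^ i) := by gcongr
        _ = (2 : ℝ) ^ i / 64 := by field_simp; norm_num
    refine ⟨G, hDAG, hindeg.le, fun _ => hindeg, fun _ => ⟨?_, fun t P hP => ?_⟩⟩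
    · refine le_trans ?_ hupper
      exact_mod_cast hsrc
    · obtain ⟨i', j, h1, h2, h3, h4, h5⟩ := hpeb t P hP
      refine ⟨i', j, h1, h2, h3, ?_, fun k hk hkj => ?_⟩
      · have h4' : (2 : ℝ) ^ i ≤
            2 * ((sources G ∩ ((Finset.Icc i' j).biUnion P \ P (i' - 1))).card : ℝ) := by
          exact_mod_cast h4
        have : (0 : ℝ) < 2 ^ i := by positivity
        linarith
      · have h5' : (2 : ℝ) ^ i ≤ 64 * ((P k).card : ℝ) := by exact_mod_cast h5 k hk hkj
        linarith
  · -- For the remaining `n` the bounds ask for a single pebble only.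
    obtain ⟨G, hDAG, hindeg, hindeg'⟩ := exists_small_digraph n
    refine ⟨G, hDAG, hindeg, hindeg', fun h2 => ?_⟩
    have hnD : (n : ℝ) ≤ D + 2 := by
      have : n ≤ D + 2 := by omega
      exact_mod_cast this
    have h2R : (2 : ℝ) ≤ n := by exact_mod_cast h2
    have hlog : 1 / 2 ≤ Real.log n := by
      have := Real.log_le_log (by norm_num) h2R
      linarith [Real.log_two_gt_d9]
    have hone : 1 / (768 * D) * n / Real.log n ≤ 1 := by
      rw [div_le_one (by linarith), one_div, inv_mul_le_iff₀ (by positivity)]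
      nlinarith
    constructor
    · rw [le_div_iff₀ (by linarith)]
      have hsrc : ((sources G).card : ℝ) ≤ n := by
        exact_mod_cast (Finset.card_le_univ _).trans (Fintype.card_fin n).le
      have hlog' : Real.log n ≤ D + 4 := (Real.log_le_self (by linarith)).trans (by linarith)
      calc ((sources G).card : ℝ) * Real.log n ≤ n * (D + 4) := by gcongr
        _ = (D + 4) * n := by ring
    · intro t P hP
      have : Nonempty (Fin n) := ⟨⟨0, by omega⟩⟩
      obtain ⟨i, h1, h3, h4, h5⟩ := hDAG.exists_first_step hP
      refine ⟨i, i, h1, le_rfl, h3, hone.trans (by exact_mod_cast h4), fun k hk hki => ?_⟩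
      obtain rfl : k = i := by omega
      exact hone.trans (by exact_mod_cast h5)

end Pebbling

theorem mainTheorem4 :
    ∃ G : (n : ℕ) → Digraph (Fin n),
      (∀ n, Pebbling.IsDAG (G n)) ∧
      (∀ n, Pebbling.indeg (G n) ≤ 2) ∧
      (∀ n, 3 ≤ n → Pebbling.indeg (G n) = 2) ∧
      ∃ c₁ c₂ c₃ : ℝ, 0 < c₁ ∧ 0 < c₂ ∧ 0 < c₃ ∧
        ∀ n : ℕ, 2 ≤ n →
          ((Pebbling.sources (G n)).card : ℝ) ≤ c₁ * n / Real.log n ∧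
          ∀ (t : ℕ) (P : ℕ → Finset (Fin n)), Pebbling.IsParallelPebbling (G n) t P →
            ∃ i j : ℕ, 1 ≤ i ∧ i ≤ j ∧ j ≤ t ∧
              c₂ * n / Real.log n ≤
                ((Pebbling.sources (G n) ∩ ((Finset.Icc i j).biUnion P \ P (i - 1))).card : ℝ) ∧
              ∀ k, i ≤ k → k ≤ j → c₃ * n / Real.log n ≤ ((P k).card : ℝ) := by
  obtain ⟨D, hD, hgraph⟩ := Pebbling.exists_digraph_log
  choose G hDAG hindeg hindeg' hpeb using hgraph
  exact ⟨G, hDAG, hindeg, hindeg', D + 4, 1 / (768 * D), 1 / (768 * D), by positivity,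
    by positivity, by positivity, hpeb⟩
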